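/- Let $p$ be an odd prime, let $d\ge 1$ be an odd integer, and let $\chi$ be a Dirichlet character modulo $d$ with values in $\mathbb{C}_p$ (for instance a primitive one, of conductor $d$). Let $\lambda,q\in\mathbb{C}_p$ with $|1-\lambda|_p<1$ and $|1-q|_p<1$. For $x\in\mathbb{N}_0$ put $[x:q]=\frac{1-q^x}{1-q}$ if $q\ne 1$ and $[x:1]=x$, and write $[2]=[2:q]=1+q$. The generalized Apostol--Changhee numbers $\mathfrak{Ch}_{n,\chi}(\lambda,q)$ are defined by the identity of formal power series in $t$ $$\frac{[2]}{(\lambda q)^d(1+\lambda t)^d+1}\sum_{j=0}^{d-1}(-1)^j\chi(j)(\lambda q)^j(1+\lambda t)^j=\sum_{n=0}^{\infty}\mathfrak{Ch}_{n,\chi}(\lambda,q)\frac{t^n}{n!}.$$ For $x\in\mathbb{Z}_p$ let $\lambda^x=\sum_{k\ge 0}\binom{x}{k}(\lambda-1)^k$ and $(x)_n=x(x-1)\cdots(x-n+1)$. Let $X_d=\varprojlim_N\mathbb{Z}/dp^N\mathbb{Z}$, with its projections $X_d\to\mathbb{Z}/d\mathbb{Z}$ and $X_d\to\mathbb{Z}_p$,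 through which $\chi(x)$ and $\lambda^{x+n}(x)_n$, respectively, are defined for $x\in X_d$. The fermionic $p$-adic $q$-integrals of functions $f$ on $X_d$ and on $\mathbb{Z}_p$ are, when the limits exist, $$\int_{X_d}f(x)\,d\mu_{-q}(x)=\lim_{N\to\infty}\frac{1}{[dp^N:-q]}\sum_{x=0}^{dp^N-1}f(x)(-q)^x,\qquad \int_{\mathbb{Z}_p}f(x)\,d\mu_{-q}(x)=\lim_{N\to\infty}\frac{1}{[p^N:-q]}\sum_{x=0}^{p^N-1}f(x)(-q)^x .$$ Then, for every integer $n\ge 0$, the following integral exists and $$\mathfrak{Ch}_{n,\chi}(\lambda,q)=\int_{X_d}\lambda^{x+n}(x)_n\,\chi(x)\,d\mu_{-q}(x).$$ If moreover $d$ is a power of $p$ (including $d=1$), so that $\chi$ is a function on $\mathbb{Z}_p$ through $\mathbb{Z}_p\to\mathbb{Z}/d\mathbb{Z}$, then the following integral also exists and $$\mathfrak{Ch}_{n,\chi}(\lambda,q)=\int_{\mathbb{Z}_p}\lambda^{x+n}(x)_n\,\chi(x)\,d\mu_{-q}(x).$$ -/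

import Mathlib

open Filter Topology

namespace ApostolChanghee

noncomputable section

/-- The `q`-number `[x : q]`, equal to `(1 - q ^ x) / (1 - q)` for `q ≠ 1` and to `x` for `q = 1`. -/
def qNumber {K : Type*} [Field K] (q : K) (x : ℕ) : K :=
  open scoped Classical in if q = 1 then (x : K) else (1 - q ^ x) / (1 - q)

/-- The generating function
`[2] / ((λ q) ^ d (1 + λ t) ^ d + 1) * ∑_{j < d} (-1) ^ j χ(j) (λ q) ^ j (1 + λ t) ^ j`
as a formal power series in `t`. -/
def genFun {K : Type*} [Field K] {d : ℕ} (χ : DirichletCharacter K d) (lam q : K) :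
    PowerSeries K :=
  PowerSeries.C (qNumber q 2) *
    (PowerSeries.C ((lam * q) ^ d) * (1 + PowerSeries.C lam * PowerSeries.X) ^ d + 1)⁻¹ *
    ∑ j ∈ Finset.range d,
      PowerSeries.C ((-1) ^ j * χ (j : ZMod d) * (lam * q) ^ j) *
        (1 + PowerSeries.C lam * PowerSeries.X) ^ j

/-- The generalized Apostol-Changhee number: `genFun χ λ q = ∑ n, changheeNumber χ λ q n * t ^ n / n!`. -/
def changheeNumber {K : Type*} [Field K] {d : ℕ} (χ : DirichletCharacter K d) (lam q : K)
    (n : ℕ) : K :=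
  (n.factorial : K) * PowerSeries.coeff n (genFun χ lam q)

variable {p : ℕ} [Fact p.Prime]

/-- The canonical inclusion of `ℤ_[p]` in `ℂ_[p]`. -/
def toCp (x : ℤ_[p]) : ℂ_[p] := algebraMap ℚ_[p] ℂ_[p] (x : ℚ_[p])

/-- The power `λ ^ x = ∑ k, (x choose k) (λ - 1) ^ k`, for `x ∈ ℤ_[p]` and `‖1 - λ‖ < 1`. -/
def cpPow (lam : ℂ_[p]) (x : ℤ_[p]) : ℂ_[p] :=
  ∑' k : ℕ, toCp (Ring.choose x k) * (lam - 1) ^ k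

/-- The falling factorial `(x)_n = x (x - 1) ⋯ (x - n + 1)`. -/
def fallingFactorial (x : ℤ_[p]) (n : ℕ) : ℤ_[p] := ∏ i ∈ Finset.range n, (x - (i : ℤ_[p]))

/-- `muNeg q M a = (-q) ^ a / [M : -q]` is the value of the distribution `μ_{-q}` on the residue
class of `a` modulo `M`. -/
def muNeg (q : ℂ_[p]) (M a : ℕ) : ℂ_[p] := (-q) ^ a / qNumber (-q) M

/-- The fermionic `p`-adic `q`-integral of `f` over `ℤ_[p]` exists and equals `I`:
`I = lim_N ∑_{x < p ^ N} f(x) μ_{-q}(x + p ^ N ℤ_[p])`. -/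
def HasIntegralZp (q : ℂ_[p]) (f : ℤ_[p] → ℂ_[p]) (I : ℂ_[p]) : Prop :=
  Tendsto (fun N : ℕ => ∑ x ∈ Finset.range (p ^ N), f (x : ℤ_[p]) * muNeg q (p ^ N) x)
    atTop (𝓝 I)

variable (p) in
/-- The profinite ring `X_d = lim_N ℤ / d p ^ N ℤ`. -/
def X (d : ℕ) : Subring ((N : ℕ) → ZMod (d * p ^ N)) where
  carrier := {x | ∀ M N : ℕ, ∀ h : M ≤ N,
    ZMod.castHom (Nat.mul_dvd_mul_left d (pow_dvd_pow p h)) (ZMod (d * p ^ M)) (x N) = x M}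
  mul_mem' ha hb M N h := by simp only [Pi.mul_apply, map_mul, ha M N h, hb M N h]
  one_mem' M N h := by simp only [Pi.one_apply, map_one]
  add_mem' ha hb M N h := by simp only [Pi.add_apply, map_add, ha M N h, hb M N h]
  zero_mem' M N h := by simp only [Pi.zero_apply, map_zero]
  neg_mem' ha M N h := by simp only [Pi.neg_apply, map_neg, ha M N h]

/-- The projection `X_d → ℤ / d ℤ`. -/
def X.toZMod (d : ℕ) : X p d →+* ZMod d :=
  ((ZMod.castHom (Dvd.intro (p ^ 0) rfl) (ZMod d)).comp
    (Pi.evalRingHom (fun N : ℕ => ZMod (d * p ^ N)) 0)).comp (X p d).subtype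

/-- The projection `X_d → ℤ / p ^ N ℤ`. -/
def X.toZModPow (d N : ℕ) : X p d →+* ZMod (p ^ N) :=
  ((ZMod.castHom (Dvd.intro_left d rfl) (ZMod (p ^ N))).comp
    (Pi.evalRingHom (fun N : ℕ => ZMod (d * p ^ N)) N)).comp (X p d).subtype

theorem X.toZModPow_compat (d : ℕ) (M N : ℕ) (h : M ≤ N) :
    (ZMod.castHom (pow_dvd_pow p h) (ZMod (p ^ M))).comp (X.toZModPow (p := p) d N) =
      X.toZModPow d M := by
  ext x
  have hx := x.2 M N h
  simp only [X.toZModPow, RingHom.comp_apply, Pi.evalRingHom_apply, Subring.subtype_apply]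
  rw [← hx, ← RingHom.comp_apply, ← RingHom.comp_apply]
  congr 1
  exact Subsingleton.elim _ _

/-- The projection `X_d → ℤ_[p]`. -/
def X.toZp (d : ℕ) : X p d →+* ℤ_[p] := PadicInt.lift (X.toZModPow_compat (p := p) d)

/-- The fermionic `p`-adic `q`-integral of `f` over `X_d` exists and equals `I`:
`I = lim_N ∑_{x < d p ^ N} f(x) μ_{-q}(x + d p ^ N X_d)`. -/
def HasIntegralX (d : ℕ) (q : ℂ_[p]) (f : X p d → ℂ_[p]) (I : ℂ_[p]) : Prop :=
  Tendsto (fun N : ℕ => ∑ x ∈ Finset.range (d * p ^ N), f (x : X p d) * muNeg q (d * p ^ N) x)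
    atTop (𝓝 I)

end

end ApostolChanghee

open Filter Topology

namespace ApostolChanghee

/-! Put `B = -λq(1 + λt)`. Since `d` is odd, the generating function is `G = (1 + q) ∑_{j<d} χ(j)
B^j / (1 - B^d)`, and periodicity of `χ` gives `G (1 - B^(dm)) = (1 + q) ∑_{x<dm} χ(x) B^x`. As `n!`
times the `n`-th coefficient of `B^x` is `(-q)^x λ^(x+n) (x)_n`, for odd `m` the Riemann sum modulo
`dm` is exactly `n!` times the `n`-th coefficient of `G (1 - B^(dm))`, divided by `1 + q^(dm)`
(`changheeSum_eq`). For `m = p^N`, `B^(dm)` tends to `-1` coefficientwise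
(`tendsto_coeff_genBase_pow`) and `q^(dm)` to `1`, so the two factors `2` cancel in the limit.
Oddness of `p` gives `‖2‖ = 1`, which keeps the denominators nonzero. -/

theorem one_add_ne_zero {K : Type*} [NormedField K] {a : K} (h2 : ‖(2 : K)‖ = 1) (ha : ‖a - 1‖ < 1) :
    1 + a ≠ 0 := by
  intro h
  rw [show a - 1 = -2 by linear_combination h, norm_neg, h2] at ha
  exact lt_irrefl _ ha

/-! ### Limits of powers and binomial coefficients in an ultrametric field -/

section Ultrametric

variable {K : Type*} [NormedField K] [IsUltrametricDist K]

theorem norm_le_one_of_norm_sub_one_lt {a : K} (ha : ‖a - 1‖ < 1) : ‖a‖ ≤ 1 := by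
  have h := IsUltrametricDist.norm_add_le_max (a - 1) 1
  rw [sub_add_cancel, norm_one] at h
  exact h.trans (max_le ha.le le_rfl)

theorem norm_pow_sub_one_le {a : K} (ha : ‖a - 1‖ < 1) (n : ℕ) : ‖a ^ n - 1‖ ≤ ‖a - 1‖ := by
  rw [← geom_sum_mul, norm_mul]
  refine mul_le_of_le_one_left (norm_nonneg _) ?_
  refine IsUltrametricDist.norm_sum_le_of_forall_le_of_nonneg zero_le_one fun i _ => ?_
  rw [norm_pow]
  exact pow_le_one₀ (norm_nonneg _) (norm_le_one_of_norm_sub_one_lt ha)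

/-- The cofactor `∑ a^i` of `a - 1` in `a^p - 1` equals `∑ (a^i - 1) + p`, and both parts have norm
at most `c`. Iterating this contraction gives `a^(p^N) → 1`. -/
theorem norm_pow_sub_one_le_mul {a : K} {c : ℝ} (p : ℕ) (hp : ‖(p : K)‖ ≤ c) (hc : c < 1)
    (ha : ‖a - 1‖ ≤ c) : ‖a ^ p - 1‖ ≤ c * ‖a - 1‖ := by
  rw [← geom_sum_mul, norm_mul]
  refine mul_le_mul_of_nonneg_right ?_ (norm_nonneg _)
  have h : ∑ i ∈ Finset.range p, a ^ i = ∑ i ∈ Finset.range p, (a ^ i - 1) + (p : K) := by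
    simp [Finset.sum_sub_distrib]
  rw [h]
  refine (IsUltrametricDist.norm_add_le_max _ _).trans (max_le ?_ hp)
  exact IsUltrametricDist.norm_sum_le_of_forall_le_of_nonneg ((norm_nonneg _).trans hp)
    fun i _ => (norm_pow_sub_one_le (ha.trans_lt hc) i).trans ha

theorem tendsto_pow_pow_one {a : K} (p : ℕ) (hp : ‖(p : K)‖ < 1) (ha : ‖a - 1‖ < 1) :
    Tendsto (fun N : ℕ => a ^ p ^ N) atTop (𝓝 1) := by
  set c := max ‖(p : K)‖ ‖a - 1‖
  have hc : c < 1 := max_lt hp ha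
  have hc0 : 0 ≤ c := (norm_nonneg _).trans (le_max_left _ _)
  have key : ∀ N : ℕ, ‖a ^ p ^ N - 1‖ ≤ c ^ N * c := by
    intro N
    induction N with
    | zero => simp [c]
    | succ N ih =>
      rw [pow_succ p, pow_mul]
      refine (norm_pow_sub_one_le_mul p (le_max_left _ _) hc
        (ih.trans (mul_le_of_le_one_left hc0 (pow_le_one₀ hc0 hc.le)))).trans ?_
      rw [pow_succ' c, mul_assoc]
      exact mul_le_mul_of_nonneg_left ih hc0
  rw [tendsto_iff_norm_sub_tendsto_zero]
  refine squeeze_zero (fun _ => norm_nonneg _) key ?_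
  simpa using (tendsto_pow_atTop_nhds_zero_of_lt_one hc0 hc).mul_const c

theorem tendsto_pow_mul_pow_one {a : K} (p d : ℕ) (hp : ‖(p : K)‖ < 1) (ha : ‖a - 1‖ < 1) :
    Tendsto (fun N : ℕ => a ^ (d * p ^ N)) atTop (𝓝 1) := by
  simpa only [← pow_mul, mul_comm, one_pow] using (tendsto_pow_pow_one p hp ha).pow d

/-- From `j * M.choose j = M * (M-1).choose (j-1)` and the bound `1` on norms of integers,
`‖M.choose j‖ ≤ ‖M‖ / ‖j‖`, and `d p^N → 0`. -/
theorem tendsto_choose_mul_pow_zero [CharZero K] (p d : ℕ) (hp : ‖(p : K)‖ < 1) {j : ℕ}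
    (hj : j ≠ 0) : Tendsto (fun N : ℕ => ((d * p ^ N).choose j : K)) atTop (𝓝 0) := by
  obtain ⟨j, rfl⟩ := Nat.exists_eq_succ_of_ne_zero hj
  have hj' : ((j + 1 : ℕ) : K) ≠ 0 := Nat.cast_ne_zero.2 j.succ_ne_zero
  have hbound : ∀ M : ℕ, ‖(M.choose (j + 1) : K)‖ ≤ ‖(M : K)‖ * ‖((j + 1 : ℕ) : K)‖⁻¹ := by
    intro M
    rw [← div_eq_mul_inv, le_div_iff₀ (norm_pos_iff.2 hj'), ← norm_mul, ← Nat.cast_mul]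
    cases M with
    | zero => simp
    | succ M =>
      rw [← Nat.add_one_mul_choose_eq, Nat.cast_mul, norm_mul]
      exact mul_le_of_le_one_right (norm_nonneg _) (IsUltrametricDist.norm_natCast_le_one K _)
  refine squeeze_zero_norm (fun N => hbound _) ?_
  have h := ((tendsto_pow_atTop_nhds_zero_of_norm_lt_one hp).const_mul (d : K)).norm.mul_const
    ‖((j + 1 : ℕ) : K)‖⁻¹
  simpa using h

end Ultrametric

/-! ### The generating function as a geometric sum -/

section PowerSeries

variable {K : Type*} [Field K]

theorem coeff_one_add_C_mul_X_pow (a : K) (m n : ℕ) :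
    PowerSeries.coeff n ((1 + PowerSeries.C a * PowerSeries.X) ^ m) = m.choose n * a ^ n := by
  have h : (1 + PowerSeries.C a * PowerSeries.X) ^ m =
      PowerSeries.rescale a (((1 + Polynomial.X : Polynomial K) ^ m : Polynomial K) :
        PowerSeries K) := by
    simp [PowerSeries.rescale_X]
  rw [h, PowerSeries.coeff_rescale, Polynomial.coeff_coe, Polynomial.coeff_one_add_X_pow, mul_comm]

theorem qNumber_two (q : K) : qNumber q 2 = 1 + q := by
  unfold qNumber
  split_ifs with h
  · rw [h]; norm_num
  · rw [div_eq_iff (sub_ne_zero.2 (Ne.symm h))]; ring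

theorem qNumber_neg_of_odd {q : K} (hq : 1 + q ≠ 0) {M : ℕ} (hM : Odd M) :
    qNumber (-q) M = (1 + q ^ M) / (1 + q) := by
  unfold qNumber
  rw [if_neg (fun h => hq (by rw [← h]; ring)), hM.neg_pow]
  simp only [sub_neg_eq_add]

theorem sum_range_mul_char_mul_pow {R : Type*} [CommRing R] {d : ℕ} (χ : ZMod d → R) (y : R)
    (m : ℕ) : (∑ x ∈ Finset.range (d * m), χ x * y ^ x) * (1 - y ^ d) =
      (∑ j ∈ Finset.range d, χ j * y ^ j) * (1 - y ^ (d * m)) := by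
  induction m with
  | zero => simp
  | succ m ih =>
    have h : ∑ i ∈ Finset.range d, χ ((d * m + i : ℕ) : ZMod d) * y ^ (d * m + i) =
        y ^ (d * m) * ∑ j ∈ Finset.range d, χ j * y ^ j := by
      rw [Finset.mul_sum]
      refine Finset.sum_congr rfl fun i _ => ?_
      rw [show ((d * m + i : ℕ) : ZMod d) = i by simp, pow_add]
      ring
    rw [Nat.mul_succ, Finset.sum_range_add, h, add_mul, ih, pow_add]
    ring

/-- The base `-λ q (1 + λ t)` of the powers occurring in `genFun`. -/
noncomputable def genBase (lam q : K) : PowerSeries K :=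
  PowerSeries.C (-(lam * q)) * (1 + PowerSeries.C lam * PowerSeries.X)

theorem genBase_pow (lam q : K) (m : ℕ) : genBase lam q ^ m =
    PowerSeries.C ((-(lam * q)) ^ m) * (1 + PowerSeries.C lam * PowerSeries.X) ^ m := by
  rw [genBase, mul_pow, map_pow]

theorem coeff_genBase_pow (lam q : K) (m n : ℕ) : PowerSeries.coeff n (genBase lam q ^ m) =
    (-(lam * q)) ^ m * (m.choose n * lam ^ n) := by
  rw [genBase_pow, PowerSeries.coeff_C_mul, coeff_one_add_C_mul_X_pow]

theorem genFun_mul_one_sub_genBase_pow {d : ℕ} (hd : Odd d) (χ : DirichletCharacter K d)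
    (lam q : K) (h : 1 + (lam * q) ^ d ≠ 0) (m : ℕ) :
    genFun χ lam q * (1 - genBase lam q ^ (d * m)) =
      PowerSeries.C (1 + q) *
        ∑ x ∈ Finset.range (d * m), PowerSeries.C (χ (x : ZMod d)) * genBase lam q ^ x := by
  have hnum : ∑ j ∈ Finset.range d,
      PowerSeries.C ((-1) ^ j * χ (j : ZMod d) * (lam * q) ^ j) *
        (1 + PowerSeries.C lam * PowerSeries.X) ^ j =
      ∑ j ∈ Finset.range d, PowerSeries.C (χ (j : ZMod d)) * genBase lam q ^ j := by
    refine Finset.sum_congr rfl fun j _ => ?_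
    rw [genBase_pow, ← mul_assoc, ← map_mul, neg_pow (lam * q)]
    congr 2
    ring
  have hden : PowerSeries.C ((lam * q) ^ d) * (1 + PowerSeries.C lam * PowerSeries.X) ^ d + 1 =
      1 - genBase lam q ^ d := by
    rw [genBase_pow, hd.neg_pow, map_neg]
    ring
  -- A nonzero constant term makes the `⁻¹` in `genFun` a genuine inverse; otherwise it would be
  -- `0`.
  have hne : PowerSeries.constantCoeff (1 - genBase lam q ^ d) ≠ 0 := by
    simpa [genBase, hd.neg_pow] using h
  have hsum := sum_range_mul_char_mul_pow (fun a : ZMod d => PowerSeries.C (χ a))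
    (genBase lam q) m
  have hinv := PowerSeries.inv_mul_cancel _ hne
  rw [genFun, hnum, hden, qNumber_two]
  linear_combination -(PowerSeries.C (1 + q) * (1 - genBase lam q ^ d)⁻¹) * hsum +
    PowerSeries.C (1 + q) *
      (∑ x ∈ Finset.range (d * m), PowerSeries.C (χ (x : ZMod d)) * genBase lam q ^ x) * hinv

end PowerSeries

/-! ### Riemann sums and their limit -/

section Padic

variable {p : ℕ} [Fact p.Prime]

theorem toCp_natCast (m : ℕ) : toCp (m : ℤ_[p]) = m := by simp [toCp]

theorem norm_natCast_prime_lt_one : ‖(p : ℂ_[p])‖ < 1 := by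
  rw [← map_natCast (algebraMap ℚ_[p] ℂ_[p]), norm_algebraMap']
  exact Padic.norm_p_lt_one

theorem norm_two_eq_one (hp : p ≠ 2) : ‖(2 : ℂ_[p])‖ = 1 := by
  rw [← Nat.cast_two, ← map_natCast (algebraMap ℚ_[p] ℂ_[p]), norm_algebraMap',
    Padic.norm_natCast_eq_one_iff]
  exact (Nat.coprime_primes Fact.out Nat.prime_two).2 hp

theorem cpPow_natCast (lam : ℂ_[p]) (m : ℕ) : cpPow lam (m : ℤ_[p]) = lam ^ m := by
  unfold cpPow
  simp only [Ring.choose_natCast, toCp_natCast]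
  rw [tsum_eq_sum (s := Finset.range (m + 1))]
  · conv_rhs => rw [← sub_add_cancel lam 1, add_pow]
    simp [mul_comm]
  · intro k hk
    rw [Finset.mem_range, not_lt] at hk
    rw [Nat.choose_eq_zero_of_lt hk, Nat.cast_zero, zero_mul]

theorem fallingFactorial_natCast (m n : ℕ) :
    fallingFactorial (m : ℤ_[p]) n = ((n.factorial * m.choose n : ℕ) : ℤ_[p]) := by
  rw [← Nat.descFactorial_eq_factorial_mul_choose, fallingFactorial]
  induction n with
  | zero => simp
  | succ n ih =>
    rw [Finset.prod_range_succ, ih, Nat.descFactorial_succ, mul_comm, Nat.cast_mul]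
    rcases le_or_gt n m with h | h
    · rw [Nat.cast_sub h]
    · simp [Nat.descFactorial_eq_zero_iff_lt.2 h]

/-- The Riemann sum of `λ ^ (x + n) (x)_n χ(x)` for `μ_{-q}` modulo `M`. -/
noncomputable def changheeSum {d : ℕ} (χ : DirichletCharacter ℂ_[p] d) (lam q : ℂ_[p])
    (n M : ℕ) : ℂ_[p] :=
  ∑ x ∈ Finset.range M, cpPow lam ((x : ℤ_[p]) + n) * toCp (fallingFactorial (x : ℤ_[p]) n) *
    χ (x : ZMod d) * muNeg q M x

theorem changheeSum_eq {d : ℕ} (hd : Odd d) (χ : DirichletCharacter ℂ_[p] d) {lam q : ℂ_[p]}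
    (hq : 1 + q ≠ 0) (h : 1 + (lam * q) ^ d ≠ 0) (n : ℕ) {m : ℕ} (hm : Odd m) :
    changheeSum χ lam q n (d * m) = n.factorial *
      PowerSeries.coeff n (genFun χ lam q * (1 - genBase lam q ^ (d * m))) /
        (1 + q ^ (d * m)) := by
  rw [genFun_mul_one_sub_genBase_pow hd χ lam q h, PowerSeries.coeff_C_mul, map_sum, changheeSum,
    Finset.mul_sum, Finset.mul_sum, Finset.sum_div]
  refine Finset.sum_congr rfl fun x _ => ?_
  rw [← Nat.cast_add, cpPow_natCast, fallingFactorial_natCast, toCp_natCast, muNeg,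
    qNumber_neg_of_odd hq (hd.mul hm), PowerSeries.coeff_C_mul, coeff_genBase_pow, Nat.cast_mul,
    div_div_eq_mul_div, mul_div_assoc', pow_add, ← mul_neg, mul_pow]
  ring

theorem tendsto_coeff_genBase_pow {d : ℕ} (hp : p ≠ 2) (hd : Odd d) {lam q : ℂ_[p]}
    (h : ‖lam * q - 1‖ < 1) (n : ℕ) :
    Tendsto (fun N : ℕ => PowerSeries.coeff n (genBase lam q ^ (d * p ^ N))) atTop
      (𝓝 (PowerSeries.coeff n (-1))) := by
  have hodd : ∀ N : ℕ, Odd (d * p ^ N) := fun N =>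
    hd.mul ((Fact.out : p.Prime).odd_of_ne_two hp).pow
  have h1 := (tendsto_pow_mul_pow_one p d norm_natCast_prime_lt_one h).neg
  simp only [coeff_genBase_pow, (hodd _).neg_pow]
  -- The constant term tends to `-1` because `d p^N` is odd; the higher ones vanish through the
  -- binomial factor.
  rcases eq_or_ne n 0 with rfl | hn
  · simpa using h1
  · have h2 := h1.mul ((tendsto_choose_mul_pow_zero p d
      (norm_natCast_prime_lt_one (p := p)) hn).mul_const (lam ^ n))
    simpa [PowerSeries.coeff_one, hn] using h2

theorem tendsto_changheeSum (hp : p ≠ 2) {d : ℕ} (hd : Odd d) (χ : DirichletCharacter ℂ_[p] d)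
    {lam q : ℂ_[p]} (hlam : ‖lam - 1‖ < 1) (hq : ‖q - 1‖ < 1) (n : ℕ) :
    Tendsto (fun N : ℕ => changheeSum χ lam q n (d * p ^ N)) atTop
      (𝓝 (changheeNumber χ lam q n)) := by
  have h2 := norm_two_eq_one hp
  have hlq : ‖lam * q - 1‖ < 1 := by
    rw [show lam * q - 1 = lam * (q - 1) + (lam - 1) by ring]
    refine (IsUltrametricDist.norm_add_le_max _ _).trans_lt (max_lt ?_ hlam)
    rw [norm_mul]
    exact (mul_le_of_le_one_left (norm_nonneg _) (norm_le_one_of_norm_sub_one_lt hlam)).trans_lt hq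
  have hne : 1 + (lam * q) ^ d ≠ 0 :=
    one_add_ne_zero h2 ((norm_pow_sub_one_le hlq d).trans_lt hlq)
  have hcoeff : Tendsto (fun N : ℕ =>
      PowerSeries.coeff n (genFun χ lam q * (1 - genBase lam q ^ (d * p ^ N)))) atTop
      (𝓝 (PowerSeries.coeff n (genFun χ lam q * (1 - -1)))) := by
    simp only [PowerSeries.coeff_mul, map_sub]
    exact tendsto_finsetSum _ fun ij _ =>
      ((tendsto_coeff_genBase_pow hp hd hlq ij.2).const_sub _).const_mul _
  have hden := (tendsto_pow_mul_pow_one p d norm_natCast_prime_lt_one hq).const_add 1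
  have hlim := (hcoeff.const_mul (n.factorial : ℂ_[p])).div hden (by norm_num)
  have hval : changheeNumber χ lam q n = n.factorial *
      PowerSeries.coeff n (genFun χ lam q * (1 - -1)) / (1 + 1) := by
    rw [changheeNumber, show genFun χ lam q * (1 - -1) = genFun χ lam q + genFun χ lam q by ring,
      map_add]
    ring
  rw [hval]
  refine hlim.congr fun N => ?_
  rw [changheeSum_eq hd χ (one_add_ne_zero h2 hq) hne n
    ((Fact.out : p.Prime).odd_of_ne_two hp).pow]
  rfl

end Padic

end ApostolChanghee

theorem mainTheorem2 {p : ℕ} [Fact p.Prime] (hp : p ≠ 2) {d : ℕ} (hd : Odd d)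
    (χ : DirichletCharacter ℂ_[p] d) (lam q : ℂ_[p]) (hlam : ‖1 - lam‖ < 1) (hq : ‖1 - q‖ < 1)
    (n : ℕ) :
    ApostolChanghee.HasIntegralX d q
        (fun x => ApostolChanghee.cpPow lam (ApostolChanghee.X.toZp d x + (n : ℤ_[p])) *
          ApostolChanghee.toCp
            (ApostolChanghee.fallingFactorial (ApostolChanghee.X.toZp d x) n) *
          χ (ApostolChanghee.X.toZMod d x))
        (ApostolChanghee.changheeNumber χ lam q n) ∧
      ∀ (k : ℕ) (hk : p ^ k = d),
        ApostolChanghee.HasIntegralZp q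
          (fun x => ApostolChanghee.cpPow lam (x + (n : ℤ_[p])) *
            ApostolChanghee.toCp (ApostolChanghee.fallingFactorial x n) *
            χ (ZMod.ringEquivCongr hk (PadicInt.toZModPow k x)))
          (ApostolChanghee.changheeNumber χ lam q n) := by
  have key := ApostolChanghee.tendsto_changheeSum hp hd χ (norm_sub_rev 1 lam ▸ hlam)
    (norm_sub_rev 1 q ▸ hq) n
  refine ⟨?_, fun k hk => ?_⟩
  · simpa only [ApostolChanghee.HasIntegralX, ApostolChanghee.changheeSum, map_natCast] using key
  -- For `d = p^k`, dropping the first `k` terms turns level `p^(N+k)` into level `d p^N`, so the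
  -- sums are the same.
  · rw [ApostolChanghee.HasIntegralZp, ← tendsto_add_atTop_iff_nat k]
    refine key.congr fun N => ?_
    rw [show p ^ (N + k) = d * p ^ N by rw [← hk, pow_add, mul_comm]]
    simp only [ApostolChanghee.changheeSum, map_natCast]
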